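/- **Setting.** Let $I$ be a finite set and let $A=(a_{ij})_{i,j\in I}$ be a real matrix with $a_{ii}=2$, with $a_{ij}\le 0$ for $i\ne j$, with $a_{ij}\neq 0\Rightarrow a_{ji}\ne 0$, and such that for $i\neq j$ either $a_{ij}a_{ji}\ge 4$ or $a_{ij}a_{ji}=4\cos^2(\pi/k)$ for some integer $k\ge 2$. For $i\ne j$ put $m_{ij}=k$ in the second case and $m_{ij}=\infty$ in the first; put $m_{ii}=1$. Let $W$ be the Coxeter group with generators $s_i$ $(i\in I)$ and relations $s_i^2=1$, $(s_is_j)^{m_{ij}}=1$ (no relation if $m_{ij}=\infty$), and let $\ell$ be its length function. Let $V$ be the real vector space with basis $(\alpha_i)_{i\in I}$, let $B$ be the bilinear form on $V$ with $B(\alpha_i,\alpha_j)=\frac12a_{ij}$, and let $W$ act on $V$ by $s_i.v=v-2B(\alpha_i,v)\alpha_i$. For $i\neq j$ with $m_{ij}$ odd let $v_{ji}=(s_is_j)^{(m_{ij}-1)/2}$; for $i\ne j$ with $m_{ij}$ even (and finite) let $v_{ji}=s_j(s_is_j)^{(m_{ij}-2)/2}$. Write $\gamma_i$ for the node indexed by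 $i\in I$. An *ON-path* is a sequence $[\gamma_{i_0},\dots,\gamma_{i_p}]$, $p\ge 0$, with $i_{k-1}\neq i_k$ and $m_{i_{k-1}i_k}$ odd for $1\le k\le p$. An *ER-sequence* rooted at $\gamma_i$ is a (possibly empty) sequence $\mathcal S=[(\gamma_i,\gamma_{l_1}),\dots,(\gamma_i,\gamma_{l_r})]$ with $l_k\ne i$ and $m_{il_k}$ even (and finite) for all $k$; put $w_{\mathcal S}=v_{l_ri}\cdots v_{l_1i}$. **Construction.** Given $(w,i)\in W\times I$, an ON-path $\mathcal P=[\gamma_{i_0},\dots,\gamma_{i_p}]$ with $i_0=i$ and ER-sequences $\mathcal S_k$ rooted at $\gamma_{i_k}$ $(0\le k\le p)$ are built recursively. If $w=1$, then $\mathcal P=[\gamma_i]$ and $\mathcal S_0$ is empty. Otherwise choose any $j\neq i$ with $\ell(ws_j)=\ell(w)-1$, let $J=\{i,j\}$, and write $w=uv$ with $v\in W_J=\langle s_i,s_j\rangle$ and $u\in W^J=\{u : \ell(us_k)>\ell(u)\ \forall k\in J\}$. If $m_{ij}$ is even (and finite), apply the construction to $(u,i)$ and put $(\gamma_i,\gamma_j)$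 in front of the first ER-sequence obtained. If $m_{ij}$ is odd, apply the construction to $(u,j)$ and put $\gamma_i$, with an empty ER-sequence, in front of the path obtained. **Statement.** Suppose $w\in W$, $i,x\in I$ and $w.\alpha_i=K\alpha_x$ for some $K>0$. Then the construction applied to $(w,i)$ has at least one outcome, and for every outcome $\mathcal P=[\gamma_{i_0},\dots,\gamma_{i_p}]$, $\mathcal S_0,\dots,\mathcal S_p$ the following hold. 1. $\mathcal P$ is an ON-path from $\gamma_i$ to $\gamma_x$, each $\mathcal S_k$ is an ER-sequence rooted at $\gamma_{i_k}$, and $$w=w_{\mathcal S_p}\,v_{i_pi_{p-1}}\,w_{\mathcal S_{p-1}}\,v_{i_{p-1}i_{p-2}}\cdots w_{\mathcal S_1}\,v_{i_1i_0}\,w_{\mathcal S_0}.$$ 2. For $j,l\in I$ let $c(j,l)$ be the total number of occurrences of $(\gamma_j,\gamma_l)$ as consecutive nodes, in this order, in $\mathcal P$, or as a pair in the sequences $\mathcal S_k$. Then $c(j,l)=0$ whenever $m_{jl}=\infty$, and (with $0\cdot\infty=0$) $$\ell(w)=\sum_{j,l\in I}c(j,l)\,(m_{jl}-1).$$ 3.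 If every factor $v_{ji}$ in the product in 1 (including those inside the $w_{\mathcal S_k}$) is replaced by any shortest word for it in the generators, the resulting word is a reduced expression for $w$. -/

import Mathlib

/-- An E-generalized Cartan matrix (E-GCM) with finite index set `I`: a real matrix with `2` on the
diagonal, nonpositive off-diagonal entries, zero pattern symmetric under transposition, such that
for `i ≠ j` either `a i j * a j i ≥ 4` or `a i j * a j i = 4 cos² (π / k)` for some integer
`k ≥ 2`. -/
structure EGCM (I : Type*) where
  /-- The entries of the matrix. -/
  a : Matrix I I ℝ
  diag : ∀ i, a i i = 2
  nonpos : ∀ i j, i ≠ j → a i j ≤ 0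
  ne_zero : ∀ i j, a i j ≠ 0 → a j i ≠ 0
  mul_cases : ∀ i j, i ≠ j →
    4 ≤ a i j * a j i ∨ ∃ k : ℕ, 2 ≤ k ∧ a i j * a j i = 4 * Real.cos (Real.pi / k) ^ 2

namespace EGCM

section

variable {I : Type*} (A : EGCM I)

/-- The exponents `m i j` of the Coxeter group, with Mathlib's convention that `0` encodes `∞`:
`m i i = 1`, and for `i ≠ j` it is the integer `k ≥ 2` with `a i j * a j i = 4 cos² (π / k)` if there
is one (there is at most one), and `0` (that is, `∞`) otherwise (recall `sInf ∅ = 0`). -/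
noncomputable def m (i j : I) : ℕ :=
  open scoped Classical in
  if i = j then 1
  else sInf {k : ℕ | 2 ≤ k ∧ A.a i j * A.a j i = 4 * Real.cos (Real.pi / k) ^ 2}

theorem m_self (i : I) : A.m i i = 1 := by simp [m]

theorem m_comm (i j : I) : A.m i j = A.m j i := by
  by_cases h : i = j
  · rw [h]
  · simp [m, h, Ne.symm h, mul_comm (A.a i j)]

theorem m_spec {i j : I} (hij : i ≠ j) (h : A.m i j ≠ 0) :
    2 ≤ A.m i j ∧ A.a i j * A.a j i = 4 * Real.cos (Real.pi / (A.m i j : ℕ)) ^ 2 := by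
  have e : A.m i j =
      sInf {k : ℕ | 2 ≤ k ∧ A.a i j * A.a j i = 4 * Real.cos (Real.pi / k) ^ 2} := by
    simp [m, hij]
  have hne : {k : ℕ | 2 ≤ k ∧ A.a i j * A.a j i = 4 * Real.cos (Real.pi / k) ^ 2}.Nonempty := by
    by_contra hc
    rw [Set.not_nonempty_iff_eq_empty] at hc
    rw [hc, Nat.sInf_empty] at e
    exact h e
  have := Nat.sInf_mem hne
  rw [← e] at this
  exact this

theorem m_ne_one {i j : I} (hij : i ≠ j) : A.m i j ≠ 1 := by
  intro h
  have := (A.m_spec hij (by omega)).1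
  omega

/-- The Coxeter matrix of the E-GCM. -/
noncomputable def coxeterMatrix : CoxeterMatrix I where
  M := Matrix.of A.m
  isSymm := by
    ext i j
    exact A.m_comm j i
  diagonal := A.m_self
  off_diagonal := fun _ _ h => A.m_ne_one h

/-- The Coxeter group `W` of the E-GCM, defined by generators and relations. -/
abbrev W : Type _ := A.coxeterMatrix.Group

/-- `W` with its distinguished generators: `A.cs.simple i` is `s_i` and `A.cs.length` is the length
function. -/
noncomputable abbrev cs : CoxeterSystem A.coxeterMatrix A.W := A.coxeterMatrix.toCoxeterSystem

/-- The generator `s_i`. -/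
noncomputable abbrev s (i : I) : A.W := A.cs.simple i

end

section

variable {I : Type*} [Fintype I] [DecidableEq I] (A : EGCM I)

/-- The simple root `α_i`, a basis vector of `V = ℝ^I`. -/
abbrev α (i : I) : I → ℝ := Pi.single i 1

/-- The (possibly asymmetric) bilinear form with `B (α_i, α_j) = a i j / 2`. -/
noncomputable def B : LinearMap.BilinForm ℝ (I → ℝ) := Matrix.toBilin' ((1 / 2 : ℝ) • A.a)

theorem B_α (i j : I) : A.B (α i) (α j) = A.a i j / 2 := by
  simp [B, α]
  ring

theorem two_smul_B_self (i : I) : ((2 : ℝ) • A.B (α i)) (α i) = 2 := by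
  simp [B_α, A.diag]

/-- The operator `S_i : v ↦ v - 2 B (α_i, v) α_i`, as an element of `GL(V)`. -/
noncomputable def S (i : I) : (I → ℝ) ≃ₗ[ℝ] (I → ℝ) := Module.reflection (A.two_smul_B_self i)

theorem S_apply (i : I) (v : I → ℝ) : A.S i v = v - (2 * A.B (α i) v) • α i := by
  simp [S, Module.reflection_apply]

theorem S_braid (i j : I) : (A.S i * A.S j) ^ A.m i j = 1 := by
  by_cases hij : i = j
  · subst hij
    rw [A.m_self, pow_one]
    ext v : 1
    exact Module.involutive_reflection (A.two_smul_B_self i) v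
  by_cases h0 : A.m i j = 0
  · rw [h0, pow_zero]
  obtain ⟨h2, hm⟩ := A.m_spec hij h0
  have key := Module.reflection_mul_reflection_pow (A.two_smul_B_self i) (A.two_smul_B_self j)
    (A.m i j) (A.a i j * A.a j i - 2) (by simp [B_α]; ring)
  apply LinearEquiv.toLinearMap_injective
  refine key.trans ?_
  set k := A.m i j with hk
  rcases h2.eq_or_lt with h2 | h3
  · have hz : A.a i j * A.a j i = 0 := by
      rw [hm, ← h2]; norm_num [Real.cos_pi_div_two]
    have hz1 : A.a i j = 0 := by
      by_contra hc
      exact (mul_ne_zero hc (A.ne_zero i j hc)) hz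
    have hz2 : A.a j i = 0 := by
      by_contra hc
      exact (mul_ne_zero (A.ne_zero j i hc) hc) hz
    rw [← h2, hz]
    apply LinearMap.ext
    intro v
    simp [B_α, hz1, hz2, -LinearMap.smul_apply]
    module
  · set θ : ℝ := Real.pi / k with hθ
    have hkpos : (3 : ℝ) ≤ k := by exact_mod_cast h3
    have hkθ : (k : ℝ) * θ = Real.pi := by rw [hθ]; field_simp
    have hsin : Real.sin (2 * θ) ≠ 0 := by
      refine (Real.sin_pos_of_pos_of_lt_pi ?_ ?_).ne'
      · have := Real.pi_pos; positivity
      · rw [← hkθ]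
        have : 0 < θ := by have := Real.pi_pos; positivity
        nlinarith
    have ht : A.a i j * A.a j i - 2 = 2 * Real.cos (2 * θ) := by
      rw [hm, Real.cos_two_mul]; ring
    have hS (n : ℤ) := Polynomial.Chebyshev.S_two_mul_real_cos (2 * θ) n
    rw [ht]
    rcases Nat.even_or_odd' k with ⟨r, hr | hr⟩
    · have e1 : ((k : ℤ) - 2) / 2 = r - 1 := by omega
      have e2 : ((k : ℤ) - 1) / 2 = r - 1 := by omega
      have hz : (Polynomial.Chebyshev.S ℝ ((r : ℤ) - 1)).eval (2 * Real.cos (2 * θ)) = 0 := by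
        have := hS (r - 1)
        have e : (((r : ℤ) - 1 : ℤ) + 1 : ℝ) * (2 * θ) = Real.pi := by
          rw [← hkθ, hr]; push_cast; ring
        rw [e, Real.sin_pi] at this
        exact (mul_eq_zero.mp this).resolve_right hsin
      rw [e1, e2, hz]
      simp
    · have e1 : ((k : ℤ) - 1) / 2 = r := by omega
      have e2 : ((k : ℤ) - 3) / 2 = r - 1 := by omega
      have e3 : ((k : ℤ)) / 2 = r := by omega
      have e4 : ((k : ℤ) - 2) / 2 = r - 1 := by omega
      have hz : (Polynomial.Chebyshev.S ℝ (r : ℤ)).eval (2 * Real.cos (2 * θ)) +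
          (Polynomial.Chebyshev.S ℝ ((r : ℤ) - 1)).eval (2 * Real.cos (2 * θ)) = 0 := by
        have h1 := hS r
        have h2 := hS (r - 1)
        have e : (((r : ℤ) : ℝ) + 1) * (2 * θ) = θ + Real.pi := by
          rw [← hkθ, hr]; push_cast; ring
        have e' : (((r : ℤ) - 1 : ℤ) + 1 : ℝ) * (2 * θ) = Real.pi - θ := by
          rw [← hkθ, hr]; push_cast; ring
        rw [e, Real.sin_add_pi] at h1
        rw [e', Real.sin_pi_sub] at h2
        have : ((Polynomial.Chebyshev.S ℝ (r : ℤ)).eval (2 * Real.cos (2 * θ)) +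
          (Polynomial.Chebyshev.S ℝ ((r : ℤ) - 1)).eval (2 * Real.cos (2 * θ))) *
            Real.sin (2 * θ) = 0 := by
          rw [add_mul, h1, h2]; ring
        exact (mul_eq_zero.mp this).resolve_right hsin
      rw [e1, e2, e3, e4, hz]
      simp

/-- The geometric representation `σ : W → GL(V)`, the homomorphism with `σ (s_i) = S_i`. -/
noncomputable def σ : A.W →* ((I → ℝ) ≃ₗ[ℝ] (I → ℝ)) :=
  A.cs.lift ⟨A.S, A.S_braid⟩

theorem σ_s (i : I) : A.σ (A.s i) = A.S i :=
  A.cs.lift_apply_simple A.S_braid i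

end

section

variable {I : Type*} (A : EGCM I)

/-- Distinct nodes `i`, `j` are odd-neighborly if `m i j` is odd. -/
def OddNeighborly (i j : I) : Prop := i ≠ j ∧ Odd (A.m i j)

/-- Distinct nodes `i`, `j` are even-related if `m i j` is even (and finite). -/
def EvenRelated (i j : I) : Prop := i ≠ j ∧ A.m i j ≠ 0 ∧ Even (A.m i j)

open scoped Classical in
/-- The element `v_{ji}`, written `A.v j i`: it is `(s_i s_j)^((m-1)/2)` if `m = m i j` is odd and
`s_j (s_i s_j)^((m-2)/2)` if `m` is even. (Used only for `i ≠ j` with `m` finite.) -/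
noncomputable def v (j i : I) : A.W :=
  if Odd (A.m i j) then (A.s i * A.s j) ^ ((A.m i j - 1) / 2)
  else A.s j * (A.s i * A.s j) ^ ((A.m i j - 2) / 2)

/-- The list of pairs `S` is an ER-sequence rooted at the node `r`: each of its members is a pair
`(r, l)` of even-related nodes. It may be empty. -/
def IsERSeq (r : I) (S : List (I × I)) : Prop := ∀ q ∈ S, q.1 = r ∧ A.EvenRelated q.1 q.2

/-- An ON-path `[i₀, …, i_p]` together with one list of pairs `S_k` for every node is stored as the
list `[(i₀, S₀), …, (i_p, S_p)]`. This predicate says that `[i₀, …, i_p]` is an ON-path (nonempty,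
consecutive nodes are odd-neighborly) from `i` to `x`, and that every `S_k` is an ER-sequence rooted
at `i_k`. -/
structure IsONPathWithER (i x : I) (D : List (I × List (I × I))) : Prop where
  chain : (D.map Prod.fst).IsChain A.OddNeighborly
  start : (D.map Prod.fst).head? = some i
  finish : (D.map Prod.fst).getLast? = some x
  er : ∀ d ∈ D, A.IsERSeq d.1 d.2

/-- The factors `v_{l_r i}, …, v_{l_1 i}`, from left to right, of the element `w_S` of the
ER-sequence `S = [(i, l_1), …, (i, l_r)]`. -/
noncomputable def erFactors (S : List (I × I)) : List A.W := (S.map fun q => A.v q.2 q.1).reverse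

/-- All the factors `v_{ji}`, from left to right, of the product
`w_{S_p} v_{i_p i_{p-1}} w_{S_{p-1}} ⋯ w_{S_1} v_{i_1 i_0} w_{S_0}`. -/
noncomputable def factors : List (I × List (I × I)) → List A.W
  | [] => []
  | [d] => A.erFactors d.2
  | d :: e :: D => factors (e :: D) ++ A.v e.1 d.1 :: A.erFactors d.2

/-- The product `w_{S_p} v_{i_p i_{p-1}} w_{S_{p-1}} ⋯ w_{S_1} v_{i_1 i_0} w_{S_0}`. -/
noncomputable def product (D : List (I × List (I × I))) : A.W := (A.factors D).prod

/-- `c (j, l)`: the number of occurrences of `(j, l)` as consecutive nodes of the path, plus the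
number of its occurrences as a pair in the ER-sequences. -/
def c [DecidableEq I] (D : List (I × List (I × I))) (j l : I) : ℕ :=
  (((D.map Prod.fst).zip (D.map Prod.fst).tail).count (j, l)) +
    (D.map fun d => d.2.count (j, l)).sum

/-- The parabolic subgroup `W_J`. -/
noncomputable def parabolic (J : Set I) : Subgroup A.W := Subgroup.closure (A.s '' J)

/-- The set `W^J` of minimal coset representatives. -/
def minCosetReps (J : Set I) : Set A.W :=
  {w | ∀ j ∈ J, A.cs.length w < A.cs.length (w * A.s j)}

/-- `A.Obtained w i D`: the recursive construction, started with the group element `w` and the node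
`i`, can output the path with ER-sequences `D`.

For `w = 1` the output is the path `[i]` with empty ER-sequence. Otherwise choose any `j ≠ i` with
`ℓ (w s_j) = ℓ (w) - 1` and write `w = u v` with `u ∈ W^J`, `v ∈ W_J`, `J = {i, j}`. If `m i j` is
even, continue with `u` and `i`, and put the pair `(i, j)` in front of the ER-sequence of the first
node of the output. If `m i j` is odd, continue with `u` and `j`, and put the node `i`, with the empty
ER-sequence, in front of the output. -/
inductive Obtained : A.W → I → List (I × List (I × I)) → Prop
  | one (i : I) : Obtained 1 i [(i, [])]
  | even {w u v : A.W} {i j : I} {S : List (I × I)} {D : List (I × List (I × I))}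
      (hj : A.cs.length (w * A.s j) + 1 = A.cs.length w)
      (hu : u ∈ A.minCosetReps {i, j}) (hv : v ∈ A.parabolic {i, j}) (hw : w = u * v)
      (hij : A.EvenRelated i j) (hD : Obtained u i ((i, S) :: D)) :
      Obtained w i ((i, (i, j) :: S) :: D)
  | odd {w u v : A.W} {i j : I} {D : List (I × List (I × I))}
      (hj : A.cs.length (w * A.s j) + 1 = A.cs.length w)
      (hu : u ∈ A.minCosetReps {i, j}) (hv : v ∈ A.parabolic {i, j}) (hw : w = u * v)
      (hij : A.OddNeighborly i j) (hD : Obtained u j D) :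
      Obtained w i ((i, []) :: D)

end

end EGCM

/-! The proof is an induction on `ℓ(w)` that removes one dihedral factor at a time. For a right
descent `j` of `w`, write `w = u v` with `v ∈ ⟨s_i, s_j⟩` and `u` a minimal coset representative.
Then `u` sends `α_i` and `α_j` to nonnegative vectors, and `v` is alternating and ends in `s_j`,
because `w.α_i` is positive and so `w s_i` is longer than `w`. Now `v.α_i = P α_i + Q α_j` with `P,
Q ≥ 0`. If both were positive, `u.α_i` and `u.α_j` would both be multiples of `α_x`, contradicting
injectivity of `u`. Hence `m_ij` is finite, `v` has length `m_ij - 1` and equals `v_ji`, and `v.α_i`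
is a positive multiple of `α_i` (`m_ij` even) or `α_j` (`m_ij` odd). So `u` satisfies the hypothesis
again, with a new constant and the node prescribed by the construction (`descent_step`). Lengths add
at each step, which gives both the length formula and reducedness.

Two inputs carry this. In rank two, rescaling makes the coefficients `P, Q` Chebyshev values that
are positive before index `m_ij` and vanish at it (`exists_σ_alternatingWord_eq`). In general, the
sign of `w.α_i` decides whether `w s_i` is longer or shorter (`σ_α_nonneg`,
`length_mul_s_of_nonneg`), even for this asymmetric form. -/

/-- The rescaled Chebyshev sequence `U 0 = 0`, `U 1 = 1`, `U (n + 2) = c * U (n + 1) - U n`. -/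
noncomputable def chebSeq (c : ℝ) : ℕ → ℝ
  | 0 => 0
  | 1 => 1
  | n + 2 => c * chebSeq c (n + 1) - chebSeq c n

/-- For `c ≥ 2` consecutive increments never decrease; this covers the case `m_ij = ∞`. -/
theorem chebSeq_pos_of_two_le {c : ℝ} (hc : 2 ≤ c) (n : ℕ) :
    0 ≤ chebSeq c n ∧ chebSeq c n + 1 ≤ chebSeq c (n + 1) := by
  induction n with
  | zero => simp [chebSeq]
  | succ n ih =>
    obtain ⟨h0, h1⟩ := ih
    refine ⟨by linarith, ?_⟩
    rw [chebSeq]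
    nlinarith

theorem chebSeq_mul_sin (θ : ℝ) (n : ℕ) :
    chebSeq (2 * Real.cos θ) n * Real.sin θ = Real.sin (n * θ) ∧
      chebSeq (2 * Real.cos θ) (n + 1) * Real.sin θ = Real.sin ((n + 1 : ℕ) * θ) := by
  induction n with
  | zero => simp [chebSeq]
  | succ n ih =>
    obtain ⟨h0, h1⟩ := ih
    refine ⟨h1, ?_⟩
    rw [chebSeq, sub_mul, mul_assoc, h0, h1]
    have e1 : (((n + 1 + 1 : ℕ) : ℝ)) * θ = (n + 1 : ℕ) * θ + θ := by push_cast; ring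
    have e2 : (n : ℝ) * θ = (n + 1 : ℕ) * θ - θ := by push_cast; ring
    rw [e1, e2, Real.sin_add, Real.sin_sub]
    ring

namespace EGCM

open CoxeterSystem

/-! ### Scaling constants and words in rank two -/

section

variable {I : Type*} (A : EGCM I)

theorem coxeterMatrix_apply (i j : I) : A.coxeterMatrix i j = A.m i j := rfl

theorem four_le_of_m_eq_zero {i j : I} (hij : i ≠ j) (h : A.m i j = 0) :
    4 ≤ A.a i j * A.a j i := by
  rcases A.mul_cases i j hij with h4 | ⟨k, hk⟩
  · exact h4
  · exfalso
    have hne : {k : ℕ | 2 ≤ k ∧ A.a i j * A.a j i = 4 * Real.cos (Real.pi / k) ^ 2}.Nonempty :=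
      ⟨k, hk⟩
    have hmem := (Nat.sInf_mem hne).1
    simp only [m, hij, if_false] at h
    omega

/-- The two simple roots `α_i`, `α_j` can be rescaled so as to make the action of the dihedral group
`⟨s_i, s_j⟩` symmetric, with Chebyshev coefficients. -/
theorem exists_scaling {i j : I} (hij : i ≠ j) :
    ∃ x y c : ℝ, 0 < x ∧ 0 < y ∧ c * x = -A.a i j * y ∧ c * y = -A.a j i * x ∧
      (∀ n, 0 < n → A.m i j = 0 ∨ n < A.m i j → 0 < chebSeq c n) ∧
      (A.m i j ≠ 0 → chebSeq c (A.m i j) = 0) := by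
  have hp : 0 ≤ -A.a i j := neg_nonneg.2 (A.nonpos i j hij)
  have hq : 0 ≤ -A.a j i := neg_nonneg.2 (A.nonpos j i hij.symm)
  obtain ⟨x, y, c, hx, hy, hc, hc2, hcx, hcy⟩ : ∃ x y c : ℝ, 0 < x ∧ 0 < y ∧ 0 ≤ c ∧
      c ^ 2 = A.a i j * A.a j i ∧ c * x = -A.a i j * y ∧ c * y = -A.a j i * x := by
    by_cases h : A.a i j = 0
    · have h' : A.a j i = 0 := by
        by_contra h'
        exact A.ne_zero j i h' h
      exact ⟨1, 1, 0, by simp [h, h']⟩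
    · have h' := A.ne_zero i j h
      have hx := Real.sqrt_pos.2 (lt_of_le_of_ne hp (Ne.symm (neg_ne_zero.2 h)))
      have hy := Real.sqrt_pos.2 (lt_of_le_of_ne hq (Ne.symm (neg_ne_zero.2 h')))
      have ex := Real.sq_sqrt hp
      have ey := Real.sq_sqrt hq
      -- The two roots are scaled by square roots of the entries, so that `c` is the geometric mean
      -- of `-a_ij` and `-a_ji`.
      refine ⟨√(-A.a i j), √(-A.a j i), √(-A.a i j) * √(-A.a j i), hx, hy, by positivity, ?_, ?_, ?_⟩
      · rw [mul_pow, ex, ey]; ring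
      · rw [← ex]; simp only [Real.sqrt_sq hx.le]; ring
      · rw [← ey]; simp only [Real.sqrt_sq hy.le]; ring
  refine ⟨x, y, c, hx, hy, hcx, hcy, ?_⟩
  by_cases hm : A.m i j = 0
  · have h4 := A.four_le_of_m_eq_zero hij hm
    have h2 : 2 ≤ c := by nlinarith
    refine ⟨fun n hn _ => ?_, fun h => absurd hm h⟩
    obtain ⟨n, rfl⟩ := Nat.exists_eq_succ_of_ne_zero hn.ne'
    have := chebSeq_pos_of_two_le h2 n
    simp only [Nat.succ_eq_add_one]
    linarith
  · obtain ⟨h2, hcos⟩ := A.m_spec hij hm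
    set k := A.m i j with hk
    have hk2 : (2 : ℝ) ≤ k := by exact_mod_cast h2
    set θ : ℝ := Real.pi / k with hθ
    have hkθ : (k : ℝ) * θ = Real.pi := by rw [hθ]; field_simp
    have hθ0 : 0 < θ := by have := Real.pi_pos; positivity
    have hθ2 : θ ≤ Real.pi / 2 := by nlinarith
    have hcθ : c = 2 * Real.cos θ := by
      have h0 : 0 ≤ Real.cos θ := Real.cos_nonneg_of_mem_Icc ⟨by linarith, hθ2⟩
      rw [← sq_eq_sq₀ hc (by positivity), hc2, hcos]
      ring
    have hsin : 0 < Real.sin θ := Real.sin_pos_of_pos_of_lt_pi hθ0 (by linarith)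
    have key := fun n => (chebSeq_mul_sin θ n).1
    rw [← hcθ] at key
    refine ⟨fun n hn h => ?_, fun _ => ?_⟩
    · have hnk : (n : ℝ) < k := by exact_mod_cast h.resolve_left hm
      have hn' : (0 : ℝ) < n := by exact_mod_cast hn
      have : 0 < Real.sin (n * θ) :=
        Real.sin_pos_of_pos_of_lt_pi (by positivity) (by rw [← hkθ]; gcongr)
      rw [← key n] at this
      exact pos_of_mul_pos_left this hsin.le
    · have := key k
      rw [hkθ, Real.sin_pi] at this
      exact (mul_eq_zero.1 this).resolve_right hsin.ne'

/-- Every element of the dihedral parabolic subgroup is the product of an alternating word of length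
at most `m i j`. -/
theorem exists_alternatingWord_of_mem_parabolic (i j : I) {v : A.W}
    (hv : v ∈ A.parabolic {i, j}) :
    ∃ n, (A.m i j = 0 ∨ n ≤ A.m i j) ∧
      (v = A.cs.wordProd (alternatingWord i j n) ∨ v = A.cs.wordProd (alternatingWord j i n)) := by
  have step : ∀ (i j : I) (v : A.W), (∃ n, (A.m i j = 0 ∨ n ≤ A.m i j) ∧
      (v = A.cs.wordProd (alternatingWord i j n) ∨
        v = A.cs.wordProd (alternatingWord j i n))) →
      ∃ n, (A.m i j = 0 ∨ n ≤ A.m i j) ∧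
      (v * A.s j = A.cs.wordProd (alternatingWord i j n) ∨
        v * A.s j = A.cs.wordProd (alternatingWord j i n)) := by
    rintro i j v ⟨n, hn, hv⟩
    have hdrop : ∀ n, (A.m i j = 0 ∨ n ≤ A.m i j) →
        v = A.cs.wordProd (alternatingWord i j n) → ∃ n, (A.m i j = 0 ∨ n ≤ A.m i j) ∧
      (v * A.s j = A.cs.wordProd (alternatingWord i j n) ∨
        v * A.s j = A.cs.wordProd (alternatingWord j i n)) := by
      rintro (_ | n) hn rfl
      · exact ⟨1, by omega, Or.inl (by simp [alternatingWord]; rfl)⟩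
      · refine ⟨n, by omega, Or.inr ?_⟩
        rw [alternatingWord_succ, wordProd_concat, simple_mul_simple_cancel_right]
    rcases hv with hv | hv
    · exact hdrop n hn hv
    -- A word ending in `s_i` is lengthened by `s_j`, unless it already has the maximal length
    -- `m_ij`; then the braid relation makes it end in `s_j`.
    · by_cases hnm : A.m i j ≠ 0 ∧ n = A.m i j
      · refine hdrop n hn ?_
        have := A.cs.wordProd_braidWord_eq i j
        rw [braidWord, braidWord, coxeterMatrix_apply, coxeterMatrix_apply, A.m_comm j i,
          ← hnm.2] at this
        rw [this, hv]
      · refine ⟨n + 1, by omega, Or.inl ?_⟩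
        rw [alternatingWord_succ, wordProd_concat, hv]
  have hgen : ∀ y ∈ A.s '' {i, j}, ∀ v : A.W, (∃ n, (A.m i j = 0 ∨ n ≤ A.m i j) ∧
      (v = A.cs.wordProd (alternatingWord i j n) ∨
        v = A.cs.wordProd (alternatingWord j i n))) →
      ∃ n, (A.m i j = 0 ∨ n ≤ A.m i j) ∧
      (v * y = A.cs.wordProd (alternatingWord i j n) ∨
        v * y = A.cs.wordProd (alternatingWord j i n)) := by
    rintro _ ⟨k, hk, rfl⟩ v h
    rcases hk with rfl | rfl
    · obtain ⟨n, h1, h2⟩ := step j k v (by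
        obtain ⟨n, h1, h2⟩ := h
        exact ⟨n, by rwa [A.m_comm], h2.symm⟩)
      exact ⟨n, by rwa [A.m_comm], h2.symm⟩
    · exact step i k v h
  induction hv using Subgroup.closure_induction_right with
  | one => exact ⟨0, by simp, Or.inl (by simp [alternatingWord])⟩
  | mul_right x hx y hy ih => exact hgen y hy x ih
  | mul_inv_cancel x hx y hy ih =>
    obtain ⟨k, hk, rfl⟩ := hy
    rw [inv_simple]
    exact hgen _ ⟨k, hk, rfl⟩ x ih

theorem v_eq_wordProd {i j : I} (h0 : A.m i j ≠ 0) :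
    A.v j i = A.cs.wordProd (alternatingWord i j (A.m i j - 1)) := by
  rw [prod_alternatingWord_eq_mul_pow, v]
  by_cases h : Odd (A.m i j)
  · rw [if_pos h, if_pos (Nat.Odd.sub_odd h odd_one), one_mul]
  · have he := Nat.not_odd_iff_even.1 h
    have h' : ¬ Even (A.m i j - 1) := by
      rw [Nat.not_even_iff_odd]
      exact Nat.Even.sub_odd (by omega) he odd_one
    obtain ⟨r, hr⟩ := he
    rw [if_neg h, if_neg h']
    congr 2
    omega

/-- Among all factorizations of `w` over `W_J`, one with `u` shortest has no right descent of `u` in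
`J`. -/
theorem exists_parabolic_decomposition (J : Set I) (w : A.W) :
    ∃ u v, u ∈ A.minCosetReps J ∧ v ∈ A.parabolic J ∧ w = u * v := by
  classical
  have hex : ∃ n u v, A.cs.length u = n ∧ v ∈ A.parabolic J ∧ w = u * v :=
    ⟨_, w, 1, rfl, one_mem _, (mul_one w).symm⟩
  obtain ⟨u, v, hu, hv, rfl⟩ := Nat.find_spec hex
  refine ⟨u, v, fun j hj => ?_, hv, rfl⟩
  by_contra hlt
  have hne : A.cs.length (u * A.s j) ≠ A.cs.length u := A.cs.length_mul_simple_ne u j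
  refine Nat.find_min hex (m := A.cs.length (u * A.s j)) (by omega)
    ⟨_, A.s j * v, rfl, mul_mem (Subgroup.subset_closure ⟨j, hj, rfl⟩) hv, ?_⟩
  rw [← mul_assoc, simple_mul_simple_cancel_right]

end

/-! ### The action of alternating words on a rank-two plane -/

section

variable {I : Type*} [Fintype I] [DecidableEq I] (A : EGCM I)

theorem S_α (i j : I) : A.S i (α j) = (α j : I → ℝ) - A.a i j • α i := by
  rw [S_apply, B_α]
  congr 2
  ring

theorem S_α_self (i : I) : A.S i (α i) = -(α i : I → ℝ) := by
  rw [S_α, A.diag]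
  module

/-- In the basis `x α_i`, `y α_j` each reflection negates its own vector and adds `c` times it to
the other, which is the Chebyshev recursion. The word grows on the left, so parity decides which
coefficient is updated. -/
theorem σ_alternatingWord {i j : I} {x y c : ℝ} (hx : c * x = -A.a i j * y)
    (hy : c * y = -A.a j i * x) (n : ℕ) :
    A.σ (A.cs.wordProd (alternatingWord i j n)) (x • α i) =
      if Even n then (chebSeq c (n + 1) * x) • α i + (chebSeq c n * y) • α j
      else (chebSeq c n * x) • α i + (chebSeq c (n + 1) * y) • α j := by
  induction n with
  | zero => simp [alternatingWord, chebSeq]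
  | succ n ih =>
    rw [alternatingWord_succ', wordProd_cons, map_mul, LinearEquiv.mul_apply, ih]
    by_cases h : Even n
    · rw [if_pos h, if_pos h, if_neg (by simpa [Nat.even_add_one] using h), σ_s, map_add, map_smul,
        map_smul, S_α_self, S_α, chebSeq]
      have : (c * chebSeq c (n + 1) - chebSeq c n) * y =
        -(chebSeq c (n + 1) * x * A.a j i) - chebSeq c n * y := by
        linear_combination chebSeq c (n + 1) * hy
      rw [this]
      module
    · rw [if_neg h, if_neg h, if_pos (by simpa [Nat.even_add_one] using h), σ_s, map_add, map_smul,
        map_smul, S_α_self, S_α, chebSeq]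
      have : (c * chebSeq c (n + 1) - chebSeq c n) * x =
        -(chebSeq c (n + 1) * y * A.a i j) - chebSeq c n * x := by
        linear_combination chebSeq c (n + 1) * hx
      rw [this]
      module

/-- The image of `α_i` under a short alternating word ending in `s_j` is a nonnegative combination
of `α_i` and `α_j`; it is a multiple of one of them only for the word `1` and for the word of length
`m i j - 1`. -/
theorem exists_σ_alternatingWord_eq {i j : I} (hij : i ≠ j) {n : ℕ}
    (hn : A.m i j = 0 ∨ n < A.m i j) :
    ∃ P Q : ℝ, 0 ≤ P ∧ 0 ≤ Q ∧
      A.σ (A.cs.wordProd (alternatingWord i j n)) (α i) = P • α i + Q • α j ∧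
      (n ≠ 0 → A.m i j ≠ n + 1 → 0 < P ∧ 0 < Q) ∧
      (A.m i j = n + 1 → if Even (A.m i j) then 0 < P ∧ Q = 0 else P = 0 ∧ 0 < Q) := by
  obtain ⟨x, y, c, hx, hy, hcx, hcy, hpos, hzero⟩ := A.exists_scaling hij
  have key := A.σ_alternatingWord hcx hcy n
  have h1 := A.m_ne_one hij
  have hU : 0 ≤ chebSeq c n := by
    rcases Nat.eq_zero_or_pos n with rfl | h
    · exact le_rfl
    · exact (hpos n h hn).le
  have hU1 : 0 ≤ chebSeq c (n + 1) := by
    by_cases h : A.m i j = n + 1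
    · rw [← h, hzero (by omega)]
    · exact (hpos (n + 1) (by omega) (by omega)).le
  have hα : (α i : I → ℝ) = x⁻¹ • x • α i := by rw [smul_smul, inv_mul_cancel₀ hx.ne', one_smul]
  by_cases he : Even n
  · rw [if_pos he] at key
    refine ⟨chebSeq c (n + 1), x⁻¹ * (chebSeq c n * y), hU1, by positivity, ?_,
      fun h0 hm => ⟨hpos _ (by omega) (by omega), ?_⟩, fun hm => ?_⟩
    · rw [hα, map_smul, key, smul_add, smul_smul, ← hα, smul_smul]
      congr 2
      field_simp
    · have := hpos n (by omega) hn
      positivity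
    · rw [if_neg (by simpa [hm, Nat.even_add_one] using he), ← hm]
      refine ⟨hzero (by omega), ?_⟩
      have := hpos n (by omega) hn
      positivity
  · rw [if_neg he] at key
    have hn0 : 0 < n := Nat.pos_of_ne_zero fun h => he (by simp [h])
    refine ⟨chebSeq c n, x⁻¹ * (chebSeq c (n + 1) * y), hU, by positivity, ?_,
      fun h0 hm => ⟨hpos _ (by omega) (by omega), ?_⟩, fun hm => ?_⟩
    · rw [hα, map_smul, key, smul_add, smul_smul, ← hα, smul_smul]
      congr 2
      field_simp
    · have := hpos (n + 1) (by omega) (by omega)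
      positivity
    · rw [if_pos (by simpa [hm, Nat.even_add_one] using he), ← hm, hzero (by omega)]
      exact ⟨hpos n hn0 hn, by simp⟩

end

/-! ### Signs of roots, lengths, and the descent step -/

section

variable {I : Type*} [Fintype I] [DecidableEq I] (A : EGCM I)

/-- If `w s_i` is longer than `w`, the root `w.α_i` is positive. -/
theorem σ_α_nonneg (w : A.W) (i : I) (h : A.cs.length w < A.cs.length (w * A.s i)) :
    0 ≤ A.σ w (α i) := by
  induction hN : A.cs.length w using Nat.strong_induction_on generalizing w i with
  | _ N ih =>
  subst hN
  by_cases hw1 : w = 1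
  · subst hw1
    simp only [map_one, LinearEquiv.coe_one, id_eq]
    exact Pi.single_nonneg.2 zero_le_one
  obtain ⟨j, hj⟩ := A.cs.exists_rightDescent_of_ne_one hw1
  have hj' : A.cs.length (w * A.s j) + 1 = A.cs.length w := A.cs.isRightDescent_iff.1 hj
  have hij : i ≠ j := by
    rintro rfl
    omega
  -- a factorization with an alternating factor of maximal length
  obtain ⟨n, ⟨u, a, b, hab, hw, hlen⟩, hmax⟩ : ∃ n,
      (∃ u a b, (a = i ∧ b = j ∨ a = j ∧ b = i) ∧ w = u * A.cs.wordProd (alternatingWord a b n) ∧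
        A.cs.length u + n = A.cs.length w) ∧
      ∀ n', (∃ u a b, (a = i ∧ b = j ∨ a = j ∧ b = i) ∧
        w = u * A.cs.wordProd (alternatingWord a b n') ∧
        A.cs.length u + n' = A.cs.length w) → n' ≤ n := by
    have hbdd : BddAbove {n | ∃ u a b, (a = i ∧ b = j ∨ a = j ∧ b = i) ∧
        w = u * A.cs.wordProd (alternatingWord a b n) ∧
        A.cs.length u + n = A.cs.length w} := by
      refine ⟨A.cs.length w, ?_⟩
      rintro n ⟨u, a, b, -, -, h⟩
      omega
    refine ⟨_, Nat.sSup_mem ?_ hbdd, fun n' hn' => le_csSup hbdd hn'⟩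
    exact ⟨0, w, i, j, by simp [alternatingWord]⟩
  have hn1 : 1 ≤ n := by
    refine hmax 1 ⟨w * A.s j, i, j, Or.inl ⟨rfl, rfl⟩, ?_, hj'⟩
    rw [alternatingWord_succ, wordProd_concat]
    simp only [alternatingWord, wordProd_nil, one_mul]
    rw [simple_mul_simple_cancel_right]
  have hle : ∀ (u' : A.W) (ω : List I), w = u' * A.cs.wordProd ω →
      A.cs.length w ≤ A.cs.length u' + ω.length := by
    rintro u' ω rfl
    exact (A.cs.length_mul_le _ _).trans (Nat.add_le_add_left (A.cs.length_wordProd_le _) _)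
  -- A length-additive factorization ending in `s_i` would make `w s_i` shorter than `w`.
  have hend : ∀ u' k, w ≠ u' * A.cs.wordProd (alternatingWord j i (k + 1)) ∨
      A.cs.length u' + (k + 1) ≠ A.cs.length w := by
    intro u' k
    by_contra! hc
    have hws : w * A.s i = u' * A.cs.wordProd (alternatingWord i j k) := by
      rw [hc.1, alternatingWord_succ, wordProd_concat, ← mul_assoc,
        simple_mul_simple_cancel_right]
    have h1 := A.cs.length_mul_le u' (A.cs.wordProd (alternatingWord i j k))
    have h2 := A.cs.length_wordProd_le (alternatingWord i j k)
    rw [← hws] at h1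
    rw [length_alternatingWord] at h2
    omega
  obtain ⟨k, rfl⟩ : ∃ k, n = k + 1 := ⟨n - 1, by omega⟩
  obtain ⟨rfl, rfl⟩ : a = i ∧ b = j := by
    rcases hab with h' | ⟨rfl, rfl⟩
    · exact h'
    · exact absurd hlen ((hend u k).resolve_left (not_not_intro hw))
  -- If `s_l` shortened `u`, it would either cancel the first letter of the alternating factor,
  -- making `w` too short, or extend that factor, against maximality.
  have hasc : ∀ l, l = a ∨ l = b → A.cs.length u < A.cs.length (u * A.s l) := by
    intro l hl
    by_contra hlt
    have hdesc : A.cs.length (u * A.s l) + 1 = A.cs.length u := by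
      rcases A.cs.length_mul_simple u l with h' | h'
      · exact absurd (by rw [h']; omega) hlt
      · exact h'
    by_cases hfirst : l = if Even k then b else a
    · have := hle (u * A.s l) (alternatingWord a b k) (by
        rw [hw, alternatingWord_succ', wordProd_cons, ← hfirst, mul_assoc])
      rw [length_alternatingWord] at this
      omega
    · have hl' : l = if Even (k + 1) then b else a := by
        by_cases hk : Even k
        · rw [if_pos hk] at hfirst
          rw [if_neg (by simpa [Nat.even_add_one] using hk)]
          tauto
        · rw [if_neg hk] at hfirst
          rw [if_pos (by simpa [Nat.even_add_one] using hk)]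
          tauto
      have := hmax (k + 1 + 1) ⟨u * A.s l, a, b, hab, by
        rw [alternatingWord_succ', wordProd_cons, ← hl', ← mul_assoc,
          simple_mul_simple_cancel_right, hw], by omega⟩
      omega
  -- Beyond `m` letters the alternating word is not reduced; at exactly `m` letters the braid
  -- relation makes it end in `s_i`.
  have hn : A.m a b = 0 ∨ k + 1 < A.m a b := by
    by_contra! hc
    rcases hc.2.lt_or_eq with hlt | heq
    · refine A.cs.not_isReduced_alternatingWord a b hc.1 hlt ?_
      refine le_antisymm (A.cs.length_wordProd_le _) ?_
      rw [length_alternatingWord]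
      have := A.cs.length_mul_le u (A.cs.wordProd (alternatingWord a b (k + 1)))
      rw [← hw] at this
      omega
    · have hbraid := A.cs.wordProd_braidWord_eq a b
      rw [braidWord, braidWord, coxeterMatrix_apply, coxeterMatrix_apply, A.m_comm b a, heq]
        at hbraid
      rw [hbraid] at hw
      exact absurd hlen ((hend u k).resolve_left (not_not_intro hw))
  obtain ⟨P, Q, hP, hQ, hPQ, -⟩ := A.exists_σ_alternatingWord_eq hij hn
  rw [hw, map_mul, LinearEquiv.mul_apply, hPQ, map_add, map_smul, map_smul]
  have ha := ih _ (by omega) u a (hasc a (Or.inl rfl)) rfl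
  have hb := ih _ (by omega) u b (hasc b (Or.inr rfl)) rfl
  exact add_nonneg (smul_nonneg hP ha) (smul_nonneg hQ hb)

theorem σ_α_ne_zero (w : A.W) (i : I) : A.σ w (α i) ≠ 0 := by
  rw [Ne, LinearEquiv.map_eq_zero_iff]
  simp

theorem σ_mul_s_α (w : A.W) (i : I) : A.σ (w * A.s i) (α i) = -A.σ w (α i) := by
  rw [map_mul, LinearEquiv.mul_apply, σ_s, S_α_self, map_neg]

/-- If `w s_i` is shorter than `w`, the root `w.α_i` is negative. -/
theorem σ_α_nonpos (w : A.W) (i : I) (h : A.cs.length (w * A.s i) < A.cs.length w) :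
    A.σ w (α i) ≤ 0 := by
  have := A.σ_α_nonneg (w * A.s i) i (by rwa [simple_mul_simple_cancel_right])
  rw [σ_mul_s_α] at this
  exact neg_nonneg.1 this

/-- A nonzero vector cannot be both nonnegative and nonpositive, so the sign of the root determines
the direction of the length change. -/
theorem length_mul_s_of_nonneg {w : A.W} {i : I} (h : 0 ≤ A.σ w (α i)) :
    A.cs.length (w * A.s i) = A.cs.length w + 1 := by
  refine (A.cs.length_mul_simple w i).resolve_right fun h' => ?_
  exact A.σ_α_ne_zero w i (le_antisymm (A.σ_α_nonpos w i (h' ▸ Nat.lt_succ_self _)) h)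

/-- A minimal representative `u` of its coset `u W_{i, j}` satisfies `ℓ (u v) = ℓ (u) + n` for the
alternating words `v` of length `n ≤ m i j`. -/
theorem length_mul_alternatingWord {i j : I} (hij : i ≠ j) {u : A.W} (hi : 0 ≤ A.σ u (α i))
    (hj : 0 ≤ A.σ u (α j)) {n : ℕ} (hn : A.m i j = 0 ∨ n ≤ A.m i j) :
    A.cs.length (u * A.cs.wordProd (alternatingWord i j n)) = A.cs.length u + n := by
  induction n generalizing i j with
  | zero => simp [alternatingWord]
  | succ n ih =>
    rw [A.m_comm] at hn
    rw [alternatingWord_succ, wordProd_concat, ← mul_assoc, length_mul_s_of_nonneg,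
      ih hij.symm hj hi (by omega), add_assoc]
    obtain ⟨P, Q, hP, hQ, hPQ, -⟩ := A.exists_σ_alternatingWord_eq hij.symm (n := n) (by omega)
    rw [map_mul, LinearEquiv.mul_apply, hPQ, map_add, map_smul, map_smul]
    exact add_nonneg (smul_nonneg hP hj) (smul_nonneg hQ hi)

/-- Two simple roots cannot be mapped by `u` to nonnegative vectors with a positive combination
supported at a single coordinate. -/
theorem false_of_σ_add_eq {i j x : I} (hij : i ≠ j) {u : A.W} (hi : 0 ≤ A.σ u (α i))
    (hj : 0 ≤ A.σ u (α j)) {P Q K : ℝ} (hP : 0 < P) (hQ : 0 < Q)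
    (h : A.σ u (P • α i + Q • α j) = K • α x) : False := by
  rw [map_add, map_smul, map_smul] at h
  have hz : ∀ y, y ≠ x → A.σ u (α i) y = 0 ∧ A.σ u (α j) y = 0 := by
    intro y hy
    have h1 := congrFun h y
    simp only [Pi.add_apply, Pi.smul_apply, smul_eq_mul, Pi.single_eq_of_ne hy, mul_zero] at h1
    have h2 : 0 ≤ A.σ u (α i) y := hi y
    have h3 : 0 ≤ A.σ u (α j) y := hj y
    constructor <;> nlinarith
  obtain ⟨p, hp⟩ : ∃ p : ℝ, A.σ u (α i) = p • (α x : I → ℝ) := by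
    refine ⟨A.σ u (α i) x, funext fun y => ?_⟩
    by_cases hy : y = x
    · subst hy; simp
    · simp [hy, (hz y hy).1]
  obtain ⟨q, hq⟩ : ∃ q : ℝ, A.σ u (α j) = q • (α x : I → ℝ) := by
    refine ⟨A.σ u (α j) x, funext fun y => ?_⟩
    by_cases hy : y = x
    · subst hy; simp
    · simp [hy, (hz y hy).2]
  -- Both images lie on the line of `α_x`; cross-multiplying gives two vectors with the same image,
  -- and injectivity forces `q = 0`.
  have heq : A.σ u (q • α i) = A.σ u (p • α j) := by
    rw [map_smul, map_smul, hp, hq, smul_smul, smul_smul, mul_comm]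
  have hjx := congrFun ((A.σ u).injective heq) i
  simp only [Pi.smul_apply, Pi.single_eq_same, Pi.single_eq_of_ne hij, smul_eq_mul, mul_one,
    mul_zero] at hjx
  rw [hjx, zero_smul] at hq
  exact A.σ_α_ne_zero u j hq

/-- One step of the recursive construction. -/
theorem descent_step {w u v : A.W} {i j x : I} {K : ℝ} (hK : 0 < K)
    (hw : A.σ w (α i) = K • α x) (hij : i ≠ j)
    (hj : A.cs.length (w * A.s j) + 1 = A.cs.length w) (hu : u ∈ A.minCosetReps {i, j})
    (hv : v ∈ A.parabolic {i, j}) (huv : w = u * v) :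
    A.m i j ≠ 0 ∧ v = A.v j i ∧ A.cs.length w = A.cs.length u + (A.m i j - 1) ∧
      A.cs.length (A.v j i) = A.m i j - 1 ∧
      ∃ K' : ℝ, 0 < K' ∧ A.σ u (α (if Even (A.m i j) then i else j)) = K' • α x := by
  have hui : 0 ≤ A.σ u (α i) := A.σ_α_nonneg u i (hu i (by simp))
  have huj : 0 ≤ A.σ u (α j) := A.σ_α_nonneg u j (hu j (by simp))
  have hwi : 0 ≤ A.σ w (α i) := by
    rw [hw]
    exact smul_nonneg hK.le (Pi.single_nonneg.2 zero_le_one)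
  -- a word ending in `s_i` is impossible
  have hend : ∀ k, (A.m i j = 0 ∨ k + 1 ≤ A.m i j) →
      v ≠ A.cs.wordProd (alternatingWord j i (k + 1)) := by
    rintro k hk rfl
    have hws : w * A.s i = u * A.cs.wordProd (alternatingWord i j k) := by
      rw [huv, alternatingWord_succ, wordProd_concat, ← mul_assoc, simple_mul_simple_cancel_right]
    have h1 := A.length_mul_s_of_nonneg hwi
    have h2 := A.length_mul_alternatingWord hij.symm huj hui (n := k + 1)
      (by rwa [A.m_comm])
    rw [← huv] at h2
    rw [hws, A.length_mul_alternatingWord hij hui huj (by omega)] at h1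
    omega
  obtain ⟨n, hn, hvn⟩ := A.exists_alternatingWord_of_mem_parabolic i j hv
  have hn0 : n ≠ 0 := by
    rintro rfl
    obtain rfl : v = 1 := by simpa [alternatingWord] using hvn
    rw [huv, mul_one] at hj
    have := hu j (by simp)
    omega
  obtain ⟨k, rfl⟩ := Nat.exists_eq_succ_of_ne_zero hn0
  rw [Nat.succ_eq_add_one] at *
  have hvk : v = A.cs.wordProd (alternatingWord i j (k + 1)) := hvn.resolve_right (hend k hn)
  have hlt : A.m i j = 0 ∨ k + 1 < A.m i j := by
    by_contra! hc
    have heq : A.m i j = k + 1 := by omega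
    refine hend k hn ?_
    have hbraid := A.cs.wordProd_braidWord_eq i j
    rw [braidWord, braidWord, coxeterMatrix_apply, coxeterMatrix_apply, A.m_comm j i, heq]
      at hbraid
    rw [hvk, hbraid]
  obtain ⟨P, Q, hP, hQ, hPQ, hpos, hlast⟩ := A.exists_σ_alternatingWord_eq hij hlt
  rw [huv, hvk, map_mul, LinearEquiv.mul_apply, hPQ] at hw
  -- Any shorter alternating word has both coefficients positive.
  have hm : A.m i j = k + 1 + 1 := by
    by_contra hm
    obtain ⟨hP', hQ'⟩ := hpos hn0 hm
    exact A.false_of_σ_add_eq hij hui huj hP' hQ' hw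
  have hm0 : A.m i j ≠ 0 := by omega
  have hveq : v = A.v j i := by rw [A.v_eq_wordProd hm0, hm, hvk]; rfl
  have hlen : A.cs.length w = A.cs.length u + (A.m i j - 1) := by
    rw [huv, hvk, A.length_mul_alternatingWord hij hui huj hn]
    omega
  refine ⟨hm0, hveq, hlen, ?_, ?_⟩
  · apply le_antisymm
    · rw [A.v_eq_wordProd hm0]
      refine (A.cs.length_wordProd_le _).trans ?_
      rw [length_alternatingWord]
    -- Subadditivity gives the lower bound, as `ℓ(w) = ℓ(u) + (m_ij - 1)`.
    · have := A.cs.length_mul_le u v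
      rw [← huv, hveq] at this
      omega
  · have hl := hlast hm
    have hdiv : ∀ {R : ℝ} {l : I}, 0 < R → R • A.σ u (α l) = K • α x →
        ∃ K' : ℝ, 0 < K' ∧ A.σ u (α l) = K' • α x := by
      intro R l hR h
      refine ⟨R⁻¹ * K, by positivity, ?_⟩
      rw [mul_smul, ← h, smul_smul, inv_mul_cancel₀ hR.ne', one_smul]
    by_cases he : Even (A.m i j)
    · rw [if_pos he] at hl ⊢
      refine hdiv hl.1 ?_
      rw [← hw, hl.2, zero_smul, add_zero, map_smul]
    · rw [if_neg he] at hl ⊢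
      refine hdiv hl.2 ?_
      rw [← hw, hl.1, zero_smul, zero_add, map_smul]

end

/-! ### Bookkeeping along the recursion -/

section

variable {I : Type*} (A : EGCM I)

theorem factors_even (i j : I) (S : List (I × I)) (D : List (I × List (I × I))) :
    A.factors ((i, (i, j) :: S) :: D) = A.factors ((i, S) :: D) ++ [A.v j i] := by
  cases D <;> simp [factors, erFactors]

theorem factors_odd (i j : I) (S : List (I × I)) (D : List (I × List (I × I))) :
    A.factors ((i, []) :: (j, S) :: D) = A.factors ((j, S) :: D) ++ [A.v j i] := by
  simp [factors, erFactors]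

theorem Obtained.exists_eq_cons {w : A.W} {i : I} {D : List (I × List (I × I))}
    (h : A.Obtained w i D) : ∃ S D', D = (i, S) :: D' := by
  cases h <;> exact ⟨_, _, rfl⟩

end

section

variable {I : Type*} [DecidableEq I] (A : EGCM I)

theorem c_even (i j : I) (S : List (I × I)) (D : List (I × List (I × I))) (k l : I) :
    c ((i, (i, j) :: S) :: D) k l = c ((i, S) :: D) k l + if k = i ∧ l = j then 1 else 0 := by
  simp only [c, List.map_cons, List.sum_cons, List.count_cons, beq_iff_eq, Prod.mk.injEq]
  simp only [eq_comm (a := i), eq_comm (a := j)]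
  omega

theorem c_odd (i j : I) (S : List (I × I)) (D : List (I × List (I × I))) (k l : I) :
    c ((i, []) :: (j, S) :: D) k l = c ((j, S) :: D) k l + if k = i ∧ l = j then 1 else 0 := by
  simp only [c, List.map_cons, List.sum_cons, List.tail_cons, List.zip_cons_cons, List.count_cons,
    List.count_nil, beq_iff_eq, Prod.mk.injEq]
  simp only [eq_comm (a := i), eq_comm (a := j)]
  omega

/-- Increasing one entry of `c` by `1` increases the weighted sum by the weight of that entry. -/
theorem sum_c_add [Fintype I] {c c' : I → I → ℕ} {i j : I}
    (h : ∀ k l, c' k l = c k l + if k = i ∧ l = j then 1 else 0) (f : I → I → ℕ) :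
    ∑ k, ∑ l, c' k l * f k l = ∑ k, ∑ l, c k l * f k l + f i j := by
  simp_rw [h, add_mul, Finset.sum_add_distrib]
  congr 1
  simp [ite_and, Finset.sum_ite_eq']

variable [Fintype I]

theorem exists_obtained {w : A.W} {i x : I} {K : ℝ} (hK : 0 < K)
    (hw : A.σ w (α i) = K • α x) : ∃ D, A.Obtained w i D := by
  induction hN : A.cs.length w using Nat.strong_induction_on generalizing w i K with
  | _ N ih =>
  subst hN
  by_cases hw1 : w = 1
  · subst hw1
    exact ⟨_, .one i⟩
  obtain ⟨j, hdesc⟩ := A.cs.exists_rightDescent_of_ne_one hw1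
  have hj : A.cs.length (w * A.s j) + 1 = A.cs.length w := A.cs.isRightDescent_iff.1 hdesc
  have hij : i ≠ j := by
    rintro rfl
    have := A.length_mul_s_of_nonneg (w := w) (i := i) (by
      rw [hw]
      exact smul_nonneg hK.le (Pi.single_nonneg.2 zero_le_one))
    omega
  obtain ⟨u, v, hu, hv, huv⟩ := A.exists_parabolic_decomposition {i, j} w
  obtain ⟨hm0, -, hlen, -, K', hK', hu'⟩ := A.descent_step hK hw hij hj hu hv huv
  have hm1 := A.m_ne_one hij
  by_cases he : Even (A.m i j)
  · rw [if_pos he] at hu'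
    obtain ⟨D, hD⟩ := ih _ (by omega) hK' hu' rfl
    obtain ⟨S, D, rfl⟩ := hD.exists_eq_cons
    exact ⟨_, .even hj hu hv huv ⟨hij, hm0, he⟩ hD⟩
  · rw [if_neg he] at hu'
    obtain ⟨D, hD⟩ := ih _ (by omega) hK' hu' rfl
    exact ⟨_, .odd hj hu hv huv ⟨hij, Nat.not_even_iff_odd.1 he⟩ hD⟩

/-- Each recursive step appends the factor `v_ji` on the right of the product and raises `c i j` by
one, and `descent_step` says this costs exactly `m_ij - 1` in length. The constant `K` varies in the
induction because it changes from `w` to `u`. -/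
theorem Obtained.spec {w : A.W} {i : I} {D : List (I × List (I × I))} (h : A.Obtained w i D)
    {x : I} {K : ℝ} (hK : 0 < K) (hw : A.σ w (α i) = K • α x) :
    A.IsONPathWithER i x D ∧ A.product D = w ∧
      (∀ k l, c D k l ≠ 0 → A.m k l ≠ 0) ∧
      A.cs.length w = ∑ k, ∑ l, c D k l * (A.m k l - 1) ∧
      ((A.factors D).map A.cs.length).sum = A.cs.length w := by
  induction h generalizing K with
  | one i =>
    have hix : i = x := by
      by_contra hne
      have := congrFun hw i
      simp [Pi.single_eq_of_ne hne] at this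
    subst hix
    refine ⟨⟨by simp, by simp, by simp, by simp [IsERSeq]⟩, ?_, ?_, ?_, ?_⟩ <;>
      simp [product, factors, erFactors, c]
  | @even w u v i j S D hj hu hv huv hij hD ih =>
    obtain ⟨hm0, hveq, hlen, hlenv, K', hK', hu'⟩ := A.descent_step hK hw hij.1 hj hu hv huv
    rw [if_pos hij.2.2] at hu'
    obtain ⟨hpath, hprod, hc, hsum, hfac⟩ := ih hK' hu'
    refine ⟨⟨by simpa using hpath.chain, by simp, by simpa using hpath.finish, ?_⟩,
      ?_, ?_, ?_, ?_⟩
    · intro d hd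
      rcases List.mem_cons.1 hd with rfl | hd
      · intro q hq
        rcases List.mem_cons.1 hq with rfl | hq
        · exact ⟨rfl, hij⟩
        · exact hpath.er (i, S) (by simp) q hq
      · exact hpath.er d (by simp [hd])
    · rw [product] at hprod ⊢
      rw [A.factors_even, List.prod_append, hprod, List.prod_singleton, huv, hveq]
    · intro k l hkl
      rw [c_even] at hkl
      by_cases h : k = i ∧ l = j
      · rwa [h.1, h.2]
      · rw [if_neg h, add_zero] at hkl
        exact hc k l hkl
    · rw [hlen, hsum, sum_c_add (c_even i j S D)]
    · rw [A.factors_even, List.map_append, List.sum_append, hfac, hlen, ← hlenv]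
      simp
  | @odd w u v i j D hj hu hv huv hij hD ih =>
    obtain ⟨hm0, hveq, hlen, hlenv, K', hK', hu'⟩ := A.descent_step hK hw hij.1 hj hu hv huv
    rw [if_neg (Nat.not_even_iff_odd.2 hij.2)] at hu'
    obtain ⟨hpath, hprod, hc, hsum, hfac⟩ := ih hK' hu'
    obtain ⟨S, D, rfl⟩ := hD.exists_eq_cons
    refine ⟨⟨?_, by simp, by simpa using hpath.finish, ?_⟩, ?_, ?_, ?_, ?_⟩
    · have := hpath.chain
      simp only [List.map_cons] at this ⊢
      exact List.isChain_cons_cons.2 ⟨hij, this⟩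
    · intro d hd
      rcases List.mem_cons.1 hd with rfl | hd
      · simp [IsERSeq]
      · exact hpath.er d hd
    · rw [product] at hprod ⊢
      rw [A.factors_odd, List.prod_append, hprod, List.prod_singleton, huv, hveq]
    · intro k l hkl
      rw [c_odd] at hkl
      by_cases h : k = i ∧ l = j
      · rwa [h.1, h.2]
      · rw [if_neg h, add_zero] at hkl
        exact hc k l hkl
    · rw [hlen, hsum, sum_c_add (c_odd i j S D)]
    · rw [A.factors_odd, List.map_append, List.sum_append, hfac, hlen, ← hlenv]
      simp

end

/-- Concatenated shortest words have total length the sum of the factor lengths; once this sum is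
`ℓ(w)`, the concatenation is reduced. -/
theorem wordProd_flatten {I : Type*} (A : EGCM I) {words : List (List I)} {gs : List A.W}
    (h : List.Forall₂ (fun ω g => A.cs.wordProd ω = g ∧ ω.length = A.cs.length g) words gs) :
    A.cs.wordProd words.flatten = gs.prod ∧
      words.flatten.length = (gs.map A.cs.length).sum := by
  induction h with
  | nil => simp
  | cons h _ ih =>
    rw [List.flatten_cons, CoxeterSystem.wordProd_append, List.length_append, h.1, h.2, ih.1, ih.2]
    simp

end EGCM

/-- Let `w.α_i = K α_x` with `K > 0`. Then the construction has an output, and every possible output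
`D` is an ON-path from `i` to `x` with ER-sequences whose product is `w`, for which
`ℓ (w) = ∑ c (j, l) (m j l - 1)`, and for which replacing each factor `v_{ji}` by any shortest word
for it gives a reduced expression of `w`. (If `m j l = ∞`, stored as `0`, then `c (j, l) = 0`, and the
summand is `0`.) -/
theorem corollary3p3 {I : Type*} [Fintype I] [DecidableEq I] (A : EGCM I)
    (w : A.W) (i x : I) (K : ℝ) (hK : 0 < K) (hw : A.σ w (EGCM.α i) = K • EGCM.α x) :
    (∃ D, A.Obtained w i D) ∧
    ∀ D, A.Obtained w i D →
      A.IsONPathWithER i x D ∧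
      A.product D = w ∧
      (∀ j l, EGCM.c D j l ≠ 0 → A.m j l ≠ 0) ∧
      A.cs.length w = ∑ j, ∑ l, EGCM.c D j l * (A.m j l - 1) ∧
      ∀ words : List (List I),
        List.Forall₂ (fun ω g => A.cs.wordProd ω = g ∧ ω.length = A.cs.length g)
          words (A.factors D) →
        A.cs.wordProd words.flatten = w ∧ A.cs.IsReduced words.flatten := by
  refine ⟨A.exists_obtained hK hw, fun D hD => ?_⟩
  obtain ⟨hpath, hprod, hc, hsum, hfac⟩ := hD.spec A hK hw
  refine ⟨hpath, hprod, hc, hsum, fun words h => ?_⟩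
  obtain ⟨h1, h2⟩ := A.wordProd_flatten h
  have h1' : A.cs.wordProd words.flatten = w := h1.trans hprod
  refine ⟨h1', ?_⟩
  rw [CoxeterSystem.IsReduced, h1', h2, hfac]
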